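/- Let $\mathfrak A$ be a $C^*$-algebra, let $H$ be a Hilbert $\mathfrak A$-module, and let $\mathcal L(H)$ be the $C^*$-algebra of adjointable operators on $H$, with identity $I$. A projection on $H$ is an element $P\in\mathcal L(H)$ with $P=P^*=P^2$; $\mathcal R(P)$ and $\mathcal N(P)$ denote its range and null space. A submodule $M\subseteq H$ is orthogonally complemented if $H=M+M^\perp$, where $M^\perp=\{x\in H:\langle x,y\rangle=0 \text{ for all } y\in M\}$; then $P_M$ denotes the projection of $H$ onto $M$. For projections $P,Q$ on $H$, the triple $(P,Q,H)$ is called matched if $\mathcal R(P)\cap\mathcal R(Q)$ is orthogonally complemented in $H$, and then $P\wedge Q:=P_{\mathcal R(P)\cap\mathcal R(Q)}$. Let $(P,Q,H)$ be a matched triple such that $$\big\|(P-P\wedge Q)(Q-P\wedge Q)\big\|<1 .$$ Then $(I-Q,I-P,H)$ is also a matched triple; that is, $\mathcal N(P)\cap\mathcal N(Q)$ is orthogonally complemented in $H$. Moreover, $\mathcal R\big((I-Q)\wedge(I-P)\big)=\mathcal N(P)\cap\mathcal N(Q)$, and the sequence $\big\{\big((I-P)(I-Q)(I-P)\big)^n\big\}_{n=1}^\infty$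 converges in operator norm to the projection $(I-Q)\wedge(I-P)=P_{\mathcal N(P)\cap\mathcal N(Q)}$. -/

import Mathlib

open Filter Topology

namespace HilbertModule

section

variable (A : Type*) {H : Type*} [NonUnitalCStarAlgebra A] [PartialOrder A] [StarOrderedRing A]
  [SMul A H] [NormedAddCommGroup H] [NormedSpace ℂ H] [CStarModule A H]

/-- `S` is an adjoint of `T` with respect to the `A`-valued inner product. -/
def IsAdjointPair (T S : H →L[ℂ] H) : Prop :=
  ∀ x y : H, inner A (T x) y = inner A x (S y)

/-- `P` is a projection on the Hilbert `A`-module `H`: it is adjointable with `P = P* = P²`. -/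
structure IsProjection (P : H →L[ℂ] H) : Prop where
  isAdjointPair_self : IsAdjointPair A P P
  mul_self : P * P = P

/-- `M^⊥`, the set of all `x` with `⟨x, y⟩ = 0` for all `y ∈ M`. -/
def orthogonal (M : Submodule ℂ H) : Submodule ℂ H where
  carrier := {x | ∀ y ∈ M, inner A x y = 0}
  add_mem' := by
    intro a b ha hb y hy
    rw [CStarModule.inner_add_left, ha y hy, hb y hy, add_zero]
  zero_mem' := by
    intro y _
    exact CStarModule.inner_zero_left
  smul_mem' := by
    intro c x hx y hy
    rw [CStarModule.inner_smul_left_complex, hx y hy, smul_zero]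

/-- `M` is orthogonally complemented in `H`, that is `H = M + M^⊥`. Such an `M` equals `M^⊥⊥`,
so it is automatically closed and stable under the action of `A`. -/
def IsOrthogonallyComplemented (M : Submodule ℂ H) : Prop :=
  M ⊔ orthogonal A M = ⊤

variable {A}

lemma IsOrthogonallyComplemented.isCompl {M : Submodule ℂ H}
    (h : IsOrthogonallyComplemented A M) : IsCompl M (orthogonal A M) := by
  refine ⟨?_, codisjoint_iff.mpr h⟩
  rw [Submodule.disjoint_def]
  intro x hx hx'
  exact (CStarModule.inner_self (A := A)).mp (hx' x hx)

lemma norm_le_norm_add {M : Submodule ℂ H} {m n : H} (hm : m ∈ M) (hn : n ∈ orthogonal A M) :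
    ‖m‖ ≤ ‖m + n‖ := by
  have h1 : inner A n m = 0 := hn m hm
  have h2 : inner A m n = 0 := by
    rw [← CStarModule.star_inner (A := A) n m, h1, star_zero]
  have h3 : inner A (m + n) (m + n) = inner A m m + inner A n n := by
    simp only [CStarModule.inner_add_right, CStarModule.inner_add_left, h1, h2, add_zero, zero_add]
  rw [CStarModule.norm_eq_sqrt_norm_inner_self (A := A) m,
    CStarModule.norm_eq_sqrt_norm_inner_self (A := A) (m + n)]
  apply Real.sqrt_le_sqrt
  refine CStarAlgebra.norm_le_norm_of_nonneg_of_le CStarModule.inner_self_nonneg ?_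
  rw [h3]
  exact le_add_of_nonneg_right CStarModule.inner_self_nonneg

/-- `P_M`, the projection of `H` onto an orthogonally complemented `M`:
it sends `m + n` to `m` for `m ∈ M` and `n ∈ M^⊥`. -/
noncomputable def IsOrthogonallyComplemented.proj {M : Submodule ℂ H}
    (h : IsOrthogonallyComplemented A M) : H →L[ℂ] H :=
  (M.projection (orthogonal A M) h.isCompl).mkContinuous 1 (by
    intro x
    have hx := Submodule.projection_add_projection_eq_self h.isCompl x
    have h3 := norm_le_norm_add (Submodule.projection_apply_mem h.isCompl x)
      (Submodule.projection_apply_mem h.isCompl.symm x)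
    rw [hx] at h3
    rwa [one_mul])

lemma IsOrthogonallyComplemented.isProjection_proj {M : Submodule ℂ H}
    (h : IsOrthogonallyComplemented A M) : IsProjection A h.proj := by
  have key : ∀ x y : H, (inner A (h.proj x) y : A) = inner A (h.proj x) (h.proj y) := by
    intro x y
    have hy : h.proj y + (orthogonal A M).projection M h.isCompl.symm y = y :=
      Submodule.projection_add_projection_eq_self h.isCompl y
    have h1 : h.proj x ∈ M := Submodule.projection_apply_mem h.isCompl x
    have h2 := Submodule.projection_apply_mem h.isCompl.symm y (h.proj x) h1
    conv_lhs => rw [← hy]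
    rw [CStarModule.inner_add_right, ← CStarModule.star_inner (A := A)
      ((orthogonal A M).projection M h.isCompl.symm y), h2, star_zero, add_zero]
  refine ⟨fun x y => ?_, ?_⟩
  · rw [key x y, ← CStarModule.star_inner (A := A) (h.proj y) x, key y x, CStarModule.star_inner]
  · ext x
    exact Submodule.projection_apply_of_mem_left h.isCompl
      (Submodule.projection_apply_mem h.isCompl x)

lemma IsOrthogonallyComplemented.range_proj {M : Submodule ℂ H}
    (h : IsOrthogonallyComplemented A M) : h.proj.range = M :=
  Submodule.range_projection h.isCompl

variable (A)

/-- `(P, Q, H)` is a matched triple: `P` and `Q` are projections on `H` and `R(P) ∩ R(Q)` is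
orthogonally complemented in `H`. -/
structure IsMatched (P Q : H →L[ℂ] H) : Prop where
  left : IsProjection A P
  right : IsProjection A Q
  complemented : IsOrthogonallyComplemented A (P.range ⊓ Q.range)

variable {A}

/-- `P ∧ Q`, the projection of `H` onto `R(P) ∩ R(Q)`, for a matched triple `(P, Q, H)`. -/
noncomputable def IsMatched.inf {P Q : H →L[ℂ] H} (h : IsMatched A P Q) : H →L[ℂ] H :=
  h.complemented.proj

end

end HilbertModule

namespace HilbertModule

section Ring

variable {R : Type*} [Ring R]

/-! Closed submodules of a Hilbert module need not be complemented, so the projection is built by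
algebra. Put `E = P ∧ Q`, `p = P - E`, `q = Q - E`. As `‖p * q‖ < 1`, `1 - p * q` has an inverse
`a`, and `W = p * u + q * v` (with `u`, `v` formed from `a`) satisfies `p * W = p`, `q * W = q`.
Hence `G = 1 - E - W` is killed by `P` and `Q`, while `1 - G` has values in `R(P) + R(Q)`,
orthogonal to `N(P) ∩ N(Q)`; so `G` is the projection sought.

For the limit, split `1 = G + E + p * u + q * v`: the compression `T` fixes `G` and kills `E` and
`p`, and `compress_pow_mul_sub` bounds the `q` term by powers of `p * q`. -/

/-- If `a` is an inverse of `1 - p * q`, then `a * p * (1 - q) + q * a * (1 - p)` is a right unit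
for both idempotents `p` and `q`. -/
lemma idempotent_mul_oblique_sum {p q a : R} (hp : p * p = p) (hq : q * q = q)
    (ha : a * (1 - p * q) = 1) (ha' : (1 - p * q) * a = 1) :
    p * (p * (a * p * (1 - q)) + q * (a * (1 - p))) = p ∧
      q * (p * (a * p * (1 - q)) + q * (a * (1 - p))) = q := by
  have e1 : a * (p * q) = a - 1 := by rw [← ha]; noncomm_ring
  have e2 : p * (q * a) = a - 1 := by rw [← ha']; noncomm_ring
  have e3 : p * (a * p) = a * p := by
    have : a = 1 + p * (q * a) := by rw [e2]; abel
    calc p * (a * p) = p * ((1 + p * (q * a)) * p) := by rw [← this]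
      _ = p * p + (p * p) * (q * a) * p := by noncomm_ring
      _ = (1 + p * (q * a)) * p := by rw [hp]; noncomm_ring
      _ = a * p := by rw [← this]
  -- The right side is `1 - a * (1 - p)`, so the whole sum equals `1 - (1 - q) * a * (1 - p)`. Both
  -- claims follow, since `q * (1 - q) = 0` and `p * (1 - q) * a = p * (1 - p * q) * a = p` modulo
  -- terms killed by `1 - p`.
  have e4 : p * (a * p * (1 - q)) = a * p - (a - 1) := by
    rw [← mul_assoc, e3, mul_sub, mul_one, mul_assoc, e1]
  constructor
  · calc p * (p * (a * p * (1 - q)) + q * (a * (1 - p)))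
        = (p * p) * (a * p * (1 - q)) + p * (q * a) * (1 - p) := by noncomm_ring
      _ = p := by rw [hp, e4, e2]; noncomm_ring
  · calc q * (p * (a * p * (1 - q)) + q * (a * (1 - p)))
        = q * (p * (a * p * (1 - q))) + (q * q) * (a * (1 - p)) := by noncomm_ring
      _ = q := by rw [hq, e4]; noncomm_ring

/-- The powers of `(1 - P) * (1 - Q) * (1 - P)`, multiplied from the right by `Q - E`. -/
lemma compress_pow_mul_sub {P Q E : R} (hP : P * P = P) (hQ : Q * Q = Q) (hPE : P * E = E)
    (hQE : Q * E = E) (hEP : E * P = E) (hEQ : E * Q = E) (hE : E * E = E) (n : ℕ) :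
    ((1 - P) * (1 - Q) * (1 - P)) ^ (n + 1) * (Q - E) =
      (1 - P) * (Q - E) * ((P - E) * (Q - E)) ^ (n + 1) := by
  have hTP : (1 - P) * (1 - Q) * (1 - P) * (1 - P) = (1 - P) * (1 - Q) * (1 - P) := by
    rw [mul_assoc, (show IsIdempotentElem P from hP).one_sub.eq]
  -- With `p = P - E`, `q = Q - E`: `P * q = p * q` and `Q * p = q * p`, while `1 - Q` kills `q` and
  -- `1 - P` kills `p`. Only `(1 - P) * q * p * q` survives.
  have h1 : (1 - P) * (1 - Q) * (1 - P) * (Q - E) = (1 - P) * (Q - E) * ((P - E) * (Q - E)) := by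
    simp only [mul_sub, sub_mul, mul_one, one_mul, mul_assoc, hP, hQ, hPE, hQE, hEQ, hE]
    simp only [← mul_assoc, hEP, hEQ]
    abel
  induction n with
  | zero => simpa using h1
  | succ n ih =>
    have h2 : ((1 - P) * (1 - Q) * (1 - P)) ^ (n + 1) * (1 - P) =
        ((1 - P) * (1 - Q) * (1 - P)) ^ (n + 1) := by
      rw [pow_succ, mul_assoc, hTP]
    rw [pow_succ, mul_assoc, h1, mul_assoc (1 - P) (Q - E), ← mul_assoc _ (1 - P), h2,
      ← mul_assoc _ (Q - E), ih, mul_assoc, ← pow_succ]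

end Ring

section Module

variable {A H : Type*} [NonUnitalCStarAlgebra A] [PartialOrder A] [SMul A H]
  [NormedAddCommGroup H] [NormedSpace ℂ H] [CStarModule A H]

lemma IsOrthogonallyComplemented.proj_mem [StarOrderedRing A] {M : Submodule ℂ H}
    (h : IsOrthogonallyComplemented A M) (x : H) : h.proj x ∈ M :=
  Submodule.projection_apply_mem h.isCompl x

lemma IsOrthogonallyComplemented.proj_eq [StarOrderedRing A] {M : Submodule ℂ H}
    (h : IsOrthogonallyComplemented A M) {G : H →L[ℂ] H} (h1 : ∀ x, G x ∈ M)
    (h2 : ∀ x, x - G x ∈ orthogonal A M) : h.proj = G := by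
  ext x
  change M.projection (orthogonal A M) h.isCompl x = G x
  conv_lhs => rw [← add_sub_cancel (G x) x]
  rw [map_add, Submodule.projection_apply_of_mem_left h.isCompl (h1 x),
    Submodule.projection_apply_of_mem_right h.isCompl (h2 x), add_zero]

lemma isOrthogonallyComplemented_of_forall_mem {M : Submodule ℂ H} {G : H → H}
    (h1 : ∀ x, G x ∈ M) (h2 : ∀ x, x - G x ∈ orthogonal A M) :
    IsOrthogonallyComplemented A M := by
  refine eq_top_iff.mpr fun x _ => ?_
  rw [← add_sub_cancel (G x) x]
  exact Submodule.add_mem_sup (h1 x) (h2 x)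

lemma IsProjection.apply_of_mem_range {P : H →L[ℂ] H} (hP : IsProjection A P) {x : H}
    (hx : x ∈ P.range) : P x = x := by
  obtain ⟨y, rfl⟩ := hx
  exact DFunLike.congr_fun hP.mul_self y

lemma IsAdjointPair.ext_left {T S S' : H →L[ℂ] H} (h : IsAdjointPair A S T)
    (h' : IsAdjointPair A S' T) : S = S' := by
  ext x
  rw [← sub_eq_zero, ← CStarModule.inner_self (A := A), CStarModule.inner_sub_left, h, h',
    sub_self]

/-- Take adjoints in `P * E = E`; uniqueness of adjoints replaces a star operation. -/
lemma IsProjection.mul_comm_of_mul_eq {P E : H →L[ℂ] H} (hP : IsProjection A P)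
    (hE : IsProjection A E) (h : P * E = E) : E * P = E := by
  refine IsAdjointPair.ext_left (A := A) (T := E) (fun x y => ?_) hE.isAdjointPair_self
  conv_rhs => rw [← h]
  exact (hE.isAdjointPair_self (P x) y).trans (hP.isAdjointPair_self x (E y))

lemma IsProjection.one_sub {P : H →L[ℂ] H} (hP : IsProjection A P) : IsProjection A (1 - P) where
  isAdjointPair_self x y := by
    change inner A (x - P x) y = inner A x (y - P y)
    rw [CStarModule.inner_sub_left, CStarModule.inner_sub_right, hP.isAdjointPair_self x y]
  mul_self := (show IsIdempotentElem P from hP.mul_self).one_sub.eq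

lemma IsProjection.range_one_sub {P : H →L[ℂ] H} (hP : IsProjection A P) :
    (1 - P).range = P.ker := by
  ext x
  constructor
  · rintro ⟨y, rfl⟩
    change P (y - P y) = 0
    rw [map_sub, sub_eq_zero]
    exact (DFunLike.congr_fun hP.mul_self y).symm
  · intro hx
    refine ⟨x, ?_⟩
    change x - P x = x
    rw [show P x = 0 from hx, sub_zero]

lemma IsProjection.range_le_orthogonal {P : H →L[ℂ] H} (hP : IsProjection A P)
    {M : Submodule ℂ H} (hM : M ≤ P.ker) : P.range ≤ orthogonal A M := by
  rintro _ ⟨x, rfl⟩ y hy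
  refine (hP.isAdjointPair_self x y).trans ?_
  rw [show P y = 0 from hM hy, CStarModule.inner_zero_right]

end Module

end HilbertModule

open HilbertModule in
theorem mainTheorem5 {A H : Type*} [NonUnitalCStarAlgebra A] [PartialOrder A] [StarOrderedRing A]
    [SMul A H] [NormedAddCommGroup H] [NormedSpace ℂ H] [CStarModule A H] [CompleteSpace H]
    (P Q : H →L[ℂ] H) (h : HilbertModule.IsMatched A P Q)
    (hnorm : ‖(P - h.inf) * (Q - h.inf)‖ < 1) :
    HilbertModule.IsOrthogonallyComplemented A (P.ker ⊓ Q.ker) ∧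
      ∃ h' : HilbertModule.IsMatched A (1 - Q) (1 - P),
        h'.inf.range = P.ker ⊓ Q.ker ∧
          Tendsto (fun n : ℕ => ((1 - P) * (1 - Q) * (1 - P)) ^ n) atTop (𝓝 h'.inf) := by
  have hP := h.left
  have hQ := h.right
  have hEproj : IsProjection A h.inf := h.complemented.isProjection_proj
  have hEmem : ∀ x, h.inf x ∈ P.range ⊓ Q.range := h.complemented.proj_mem
  set E := h.inf
  have hPE : P * E = E := by ext x; exact hP.apply_of_mem_range (hEmem x).1
  have hQE : Q * E = E := by ext x; exact hQ.apply_of_mem_range (hEmem x).2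
  have hEP : E * P = E := hP.mul_comm_of_mul_eq hEproj hPE
  have hEQ : E * Q = E := hQ.mul_comm_of_mul_eq hEproj hQE
  have hE := hEproj.mul_self
  have hp : (P - E) * (P - E) = P - E := by
    rw [mul_sub, sub_mul, sub_mul, hP.mul_self, hPE, hEP, hE]; abel
  have hq : (Q - E) * (Q - E) = Q - E := by
    rw [mul_sub, sub_mul, sub_mul, hQ.mul_self, hQE, hEQ, hE]; abel
  have hPp : P * (P - E) = P - E := by rw [mul_sub, hP.mul_self, hPE]
  have hQq : Q * (Q - E) = Q - E := by rw [mul_sub, hQ.mul_self, hQE]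
  have hEp : E * (P - E) = 0 := by rw [mul_sub, hEP, hE, sub_self]
  have hEq : E * (Q - E) = 0 := by rw [mul_sub, hEQ, hE, sub_self]
  -- Neumann series.
  obtain ⟨a, ha', ha⟩ := isUnit_iff_exists.mp (isUnit_one_sub_of_norm_lt_one hnorm)
  obtain ⟨hpW, hqW⟩ := idempotent_mul_oblique_sum hp hq ha ha'
  set u := a * (P - E) * (1 - (Q - E))
  set v := a * (1 - (P - E))
  set G := 1 - E - ((P - E) * u + (Q - E) * v) with hG
  have hEW : E * ((P - E) * u + (Q - E) * v) = 0 := by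
    rw [mul_add, ← mul_assoc E, ← mul_assoc E, hEp, hEq, zero_mul, zero_mul, add_zero]
  have hPG : P * G = 0 := by
    calc P * G = P - P * E - ((P - E) * ((P - E) * u + (Q - E) * v)
          + E * ((P - E) * u + (Q - E) * v)) := by rw [hG]; noncomm_ring
      _ = 0 := by rw [hpW, hEW, hPE, add_zero, sub_self]
  have hQG : Q * G = 0 := by
    calc Q * G = Q - Q * E - ((Q - E) * ((P - E) * u + (Q - E) * v)
          + E * ((P - E) * u + (Q - E) * v)) := by rw [hG]; noncomm_ring
      _ = 0 := by rw [hqW, hEW, hQE, add_zero, sub_self]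
  have hGmem : ∀ x, G x ∈ P.ker ⊓ Q.ker := fun x =>
    ⟨DFunLike.congr_fun hPG x, DFunLike.congr_fun hQG x⟩
  have hGorth : ∀ x, x - G x ∈ orthogonal A (P.ker ⊓ Q.ker) := by
    intro x
    have e : x - G x = P (E x + (P - E) (u x)) + Q ((Q - E) (v x)) := by
      have e1 : P (E x) = E x := DFunLike.congr_fun hPE x
      have e2 : P ((P - E) (u x)) = (P - E) (u x) := DFunLike.congr_fun hPp (u x)
      have e3 : Q ((Q - E) (v x)) = (Q - E) (v x) := DFunLike.congr_fun hQq (v x)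
      rw [map_add, e1, e2, e3]
      change x - (x - E x - ((P - E) (u x) + (Q - E) (v x))) = _
      abel
    rw [e]
    exact add_mem (hP.range_le_orthogonal inf_le_left ⟨_, rfl⟩)
      (hQ.range_le_orthogonal inf_le_right ⟨_, rfl⟩)
  have hM : (1 - Q).range ⊓ (1 - P).range = P.ker ⊓ Q.ker := by
    rw [hQ.range_one_sub, hP.range_one_sub, inf_comm]
  have hcompl := isOrthogonallyComplemented_of_forall_mem hGmem hGorth
  have h' : IsMatched A (1 - Q) (1 - P) := ⟨hQ.one_sub, hP.one_sub, by rwa [hM]⟩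
  have hinf : h'.inf = G := h'.complemented.proj_eq (by rwa [hM]) (by rwa [hM])
  refine ⟨hcompl, h', h'.complemented.range_proj.trans hM, ?_⟩
  rw [hinf]
  set T := (1 - P) * (1 - Q) * (1 - P) with hT
  have hTG : T * G = G := by
    have e1 : (1 - P) * G = G := by rw [sub_mul, hPG, one_mul, sub_zero]
    have e2 : (1 - Q) * G = G := by rw [sub_mul, hQG, one_mul, sub_zero]
    rw [hT, mul_assoc, e1, mul_assoc, e2, e1]
  have hTnG : ∀ n, T ^ n * G = G := by
    intro n
    induction n with
    | zero => rw [pow_zero, one_mul]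
    | succ n ih => rw [pow_succ, mul_assoc, hTG, ih]
  have hTE : T * E = 0 := by rw [hT, mul_assoc, sub_mul 1 P E, hPE, one_mul, sub_self, mul_zero]
  have hTp : T * (P - E) = 0 := by rw [hT, mul_assoc, sub_mul 1 P (P - E), hPp, one_mul, sub_self, mul_zero]
  -- The exponent starts at 1: one factor `T` is needed to kill `E` and `P - E`.
  have hpow : ∀ n : ℕ, T ^ (n + 1) =
      G + (1 - P) * (Q - E) * ((P - E) * (Q - E)) ^ (n + 1) * v := by
    intro n
    calc T ^ (n + 1) = T ^ (n + 1) * G + T ^ n * (T * E) + T ^ n * (T * (P - E)) * u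
          + T ^ (n + 1) * (Q - E) * v := by rw [hG, pow_succ]; noncomm_ring
      _ = _ := by
        rw [hTnG, hTE, hTp, hT,
          compress_pow_mul_sub hP.mul_self hQ.mul_self hPE hQE hEP hEQ hE]
        simp only [mul_zero, zero_mul, add_zero]
  rw [← tendsto_add_atTop_iff_nat 1]
  simp only [hpow]
  have h0 := (tendsto_add_atTop_iff_nat 1).mpr (tendsto_pow_atTop_nhds_zero_of_norm_lt_one hnorm)
  simpa using ((h0.const_mul ((1 - P) * (Q - E))).mul_const v).const_add G
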